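/- For elements $a,q$ of a commutative ring and $k\ge 0$ write $(a;q)_k=\prod_{i=0}^{k-1}(1-aq^i)$, and for $0\le m\le n$ let $\left[\begin{matrix} n\\ m\end{matrix}\right]_q=(q^{n-m+1};q)_m/(q;q)_m$ be the Gaussian polynomial (a polynomial in $q$, which may be evaluated at every element $q$ of a field). Let $K$ be any field and $n\ge 0$ an integer. (1) For all nonzero $x,y\in K$ with $x^iy^{i-1}\ne 1$ for $1\le i\le n$, $$\sum_{m=0}^n\left(x^{\lfloor m/2\rfloor+1}y^{\lfloor m/2\rfloor}\right)^{\lceil m/2\rceil}\frac{\left[\begin{matrix} n-\lceil m/2\rceil\\ \lfloor m/2\rfloor\end{matrix}\right]_{xy}}{(x;xy)_{\lceil m/2\rceil}\,(x^ny^{n-1};(xy)^{-1})_{\lfloor m/2\rfloor}}=\prod_{i=1}^n \frac{1}{1-x^iy^{i-1}}.$$ (2) For all $a,q\in K$ with $q\ne 0$ and $aq^i\ne 1$ for $0\le i\le n-1$, $$\sum_{m=0}^n\left(aq^{\lfloor m/2\rfloor}\right)^{\lceil m/2\rceil}\frac{\left[\begin{matrix} n-\lceil m/2\rceil\\ \lfloor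 m/2\rfloor\end{matrix}\right]_{q}}{(a;q)_{\lceil m/2\rceil}\,(aq^{n-1};q^{-1})_{\lfloor m/2\rfloor}}=\frac{1}{(a;q)_n}.$$ In particular (taking $K=\mathbb{Q}(x,y)$, respectively $K=\mathbb{Q}(a,q)$) both are identities of rational functions in indeterminates. -/

import Mathlib

open Polynomial

/-- The `q`-shifted factorial `(a; q)_n = ∏_{i=0}^{n-1} (1 - a q^i)`. -/
def qPoch {R : Type*} [CommRing R] (a q : R) (n : ℕ) : R :=
  ∏ i ∈ Finset.range n, (1 - a * q ^ i)

/-- The Gaussian polynomial `(X^{n-m+1}; X)_m / (X; X)_m`, where the quotient is taken in the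
polynomial ring `K[X]` (the division is exact, see `gaussPoly_mul`); it is `0` for `m > n`. -/
noncomputable def gaussPoly (K : Type*) [Field K] (n m : ℕ) : K[X] :=
  if m ≤ n then qPoch ((X : K[X]) ^ (n - m + 1)) X m / qPoch (X : K[X]) X m else 0

/-- The Gaussian polynomial at the point `q`. It agrees with the quotient
`(q^{n-m+1}; q)_m / (q; q)_m` whenever `(q; q)_m ≠ 0`, see `gaussBinom_eq_div`. -/
noncomputable def gaussBinom {K : Type*} [Field K] (n m : ℕ) (q : K) : K :=
  (gaussPoly K n m).eval q

theorem qPoch_X_ne_zero (K : Type*) [Field K] (m : ℕ) : qPoch (X : K[X]) X m ≠ 0 := by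
  intro h
  have h2 := congrArg (Polynomial.eval (0 : K)) h
  simp [qPoch, Polynomial.eval_prod] at h2

theorem qPoch_dvd {R : Type*} [CommRing R] (q : R) (k m : ℕ) :
    qPoch q q m ∣ qPoch (q ^ (k + 1)) q m := by
  induction m generalizing k with
  | zero => simp [qPoch]
  | succ m ihm =>
    induction k with
    | zero => simp
    | succ k ihk =>
      have e1 : qPoch (q ^ (k + 1 + 1)) q (m + 1)
          = qPoch (q ^ (k + 1 + 1)) q m * (1 - q ^ (k + m + 2)) := by
        rw [qPoch, Finset.prod_range_succ, ← qPoch]; congr 1; ring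
      have e2 : qPoch (q ^ (k + 1)) q (m + 1)
          = (1 - q ^ (k + 1)) * qPoch (q ^ (k + 1 + 1)) q m := by
        rw [qPoch, Finset.prod_range_succ', mul_comm, qPoch]
        congr 1
        · ring
        · exact Finset.prod_congr rfl fun i _ => by ring
      have e3 : qPoch q q (m + 1) = qPoch q q m * (1 - q ^ (m + 1)) := by
        rw [qPoch, Finset.prod_range_succ, ← qPoch]; congr 1; ring
      have e4 : qPoch (q ^ (k + 1 + 1)) q (m + 1) = qPoch (q ^ (k + 1)) q (m + 1)
          + q ^ (k + 1) * (qPoch (q ^ (k + 1 + 1)) q m * (1 - q ^ (m + 1))) := by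
        rw [e1, e2]; ring
      rw [e4]
      refine dvd_add ihk (Dvd.dvd.mul_left ?_ _)
      rw [e3]
      exact mul_dvd_mul (ihm (k + 1)) dvd_rfl

theorem gaussPoly_mul (K : Type*) [Field K] {n m : ℕ} (h : m ≤ n) :
    gaussPoly K n m * qPoch (X : K[X]) X m = qPoch ((X : K[X]) ^ (n - m + 1)) X m := by
  rw [gaussPoly, if_pos h, mul_comm]
  exact EuclideanDomain.mul_div_cancel' (qPoch_X_ne_zero K m) (qPoch_dvd _ _ _)

theorem gaussBinom_eq_div {K : Type*} [Field K] {n m : ℕ} (h : m ≤ n) (q : K)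
    (hq : qPoch q q m ≠ 0) :
    gaussBinom n m q = qPoch (q ^ (n - m + 1)) q m / qPoch q q m := by
  rw [eq_div_iff hq]
  simpa [gaussBinom, qPoch, Polynomial.eval_prod] using
    congrArg (Polynomial.eval q) (gaussPoly_mul K h)

/-!
Part (1) is part (2) at `a = x`, `q = x y`, because `x ^ i * y ^ (i - 1) = x * (x * y) ^ (i - 1)`.

For part (2), put `r = ⌈m/2⌉` and `s = ⌊m/2⌋`. Since
`(a; q)_n = (a; q)_r * (a q^r; q)_{n-m} * (a q^(n-1); q⁻¹)_s`, multiplying by `(a; q)_n` turns the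
claim into the denominator-free identity `∑ (a q^s)^r [n-r, s] (a q^r; q)_{n-m} = 1`.

Let `B_n(a)` be the sum of the terms of even index `m = 2s` (`evenSum`). The terms of odd index
`m = 2s + 1` of the `(n+1)`-st sum add up to `a B_n(aq)`, so what has to be shown is
`B_{n+1}(a) + a B_n(aq) = 1`. The two `q`-Pascal rules give two recurrences for the terms
of `B_n` (`evenTerm_add_two` and `evenTerm_add_two'`), and together these give
`B_{n+3}(a) - B_{n+2}(a) = a² q^(n+2) (B_{n+1}(aq) - B_n(aq))` (`evenSum_sub_rec`). Hence
`B_{n+1}(a) - B_n(a) = (-a)^(n+1) q^(n(n+1)/2)`, i.e. `B_n` is a truncated partial theta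
series, and `B_{n+1}(a) + a B_n(aq)` does not depend on `n`.
-/

/-! ### Shifted factorials -/

section QPoch

variable {R : Type*} [CommRing R]

theorem qPoch_succ (a q : R) (n : ℕ) : qPoch a q (n + 1) = qPoch a q n * (1 - a * q ^ n) :=
  Finset.prod_range_succ _ _

theorem qPoch_add (a q : R) (m n : ℕ) :
    qPoch a q (m + n) = qPoch a q m * qPoch (a * q ^ m) q n := by
  simp only [qPoch, Finset.prod_range_add, pow_add, mul_assoc]

theorem qPoch_succ' (a q : R) (n : ℕ) : qPoch a q (n + 1) = (1 - a) * qPoch (a * q) q n := by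
  rw [add_comm, qPoch_add]
  simp [qPoch]

end QPoch

theorem qPoch_inv {K : Type*} [Field K] (a : K) {q : K} (hq : q ≠ 0) (k s : ℕ) :
    qPoch (a * q ^ (k + s - 1)) q⁻¹ s = qPoch (a * q ^ k) q s := by
  unfold qPoch
  rw [← Finset.prod_range_reflect]
  refine Finset.prod_congr rfl fun i hi => ?_
  have hi := Finset.mem_range.1 hi
  have h : k + s - 1 = k + i + (s - 1 - i) := by omega
  rw [h, pow_add q (k + i), inv_pow, ← mul_assoc, mul_assoc _ _ (_)⁻¹,
    mul_inv_cancel₀ (pow_ne_zero _ hq), mul_one, pow_add, mul_assoc]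

/-! ### Gaussian polynomials -/

section Gauss

variable {K : Type*} [Field K]

theorem gaussBinom_eq_zero {n m : ℕ} (h : n < m) (q : K) : gaussBinom n m q = 0 := by
  simp [gaussBinom, gaussPoly, not_le.2 h]

theorem gaussBinom_zero_right (n : ℕ) (q : K) : gaussBinom n 0 q = 1 := by
  simp [gaussBinom, gaussPoly, qPoch]

/-- The defining relation of the Gaussian polynomial; it persists in the vanishing case `k = 0`,
where the right-hand side contains the factor `1 - X ^ 0`. -/
theorem gaussPoly_add_succ_mul (k m : ℕ) :
    gaussPoly K (k + m) (m + 1) * qPoch (X : K[X]) X (m + 1)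
      = qPoch ((X : K[X]) ^ k) X (m + 1) := by
  rcases k with _ | k
  · simp [gaussPoly, qPoch_succ']
  · rw [gaussPoly_mul K (by omega)]
    congr 2
    omega

theorem gaussPoly_add_mul (k m : ℕ) :
    gaussPoly K (k + m) m * qPoch (X : K[X]) X m = qPoch ((X : K[X]) ^ (k + 1)) X m := by
  rw [gaussPoly_mul K (by omega), Nat.add_sub_cancel]

theorem gaussBinom_pascal (k m : ℕ) (q : K) :
    gaussBinom (k + m + 1) (m + 1) q
      = gaussBinom (k + m) (m + 1) q + q ^ k * gaussBinom (k + m) m q := by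
  have key : gaussPoly K (k + m + 1) (m + 1)
      = gaussPoly K (k + m) (m + 1) + X ^ k * gaussPoly K (k + m) m := by
    apply mul_right_cancel₀ (qPoch_X_ne_zero K (m + 1))
    have h1 := gaussPoly_add_succ_mul (K := K) (k + 1) m
    have h2 := gaussPoly_add_succ_mul (K := K) k m
    have h3 := gaussPoly_add_mul (K := K) k m
    rw [show k + 1 + m = k + m + 1 by ring, qPoch_succ _ _ m, qPoch_succ] at h1
    rw [qPoch_succ' (X ^ k), qPoch_succ, ← pow_succ] at h2
    rw [qPoch_succ]
    linear_combination h1 - h2 - X ^ k * (1 - X * X ^ m) * h3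
  simp [gaussBinom, key]

theorem gaussBinom_pascal' (k m : ℕ) (q : K) :
    gaussBinom (k + m + 1) (m + 1) q
      = q ^ (m + 1) * gaussBinom (k + m) (m + 1) q + gaussBinom (k + m) m q := by
  have key : gaussPoly K (k + m + 1) (m + 1)
      = X ^ (m + 1) * gaussPoly K (k + m) (m + 1) + gaussPoly K (k + m) m := by
    apply mul_right_cancel₀ (qPoch_X_ne_zero K (m + 1))
    have h1 := gaussPoly_add_succ_mul (K := K) (k + 1) m
    have h2 := gaussPoly_add_succ_mul (K := K) k m
    have h3 := gaussPoly_add_mul (K := K) k m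
    rw [show k + 1 + m = k + m + 1 by ring, qPoch_succ _ _ m, qPoch_succ] at h1
    rw [qPoch_succ' (X ^ k), qPoch_succ, ← pow_succ] at h2
    rw [qPoch_succ]
    linear_combination h1 - X ^ (m + 1) * h2 - (1 - X * X ^ m) * h3
  simp [gaussBinom, key]

/-! ### The terms of even index -/

/-- The term of index `m = 2s` of the sum of order `n`, after multiplication by `(a; q)_n`. It
vanishes for `2s > n`, because the Gaussian polynomial does. -/
noncomputable def evenTerm (q : K) (n s : ℕ) (a : K) : K :=
  (a * q ^ s) ^ s * gaussBinom (n - s) s q * qPoch (a * q ^ s) q (n - 2 * s)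

theorem evenTerm_eq_zero {n s : ℕ} (h : n < 2 * s) (q a : K) : evenTerm q n s a = 0 := by
  rw [evenTerm, gaussBinom_eq_zero (by omega), mul_zero, zero_mul]

theorem evenTerm_zero (q : K) (n : ℕ) (a : K) : evenTerm q n 0 a = qPoch a q n := by
  simp [evenTerm, gaussBinom_zero_right]

/-- The recurrence coming from the first `q`-Pascal rule, with the last factor of the shifted
factorial split off; the first summand keeps the parameter `a`. -/
theorem evenTerm_add_two (q a : K) {n s : ℕ} (hs : s ≤ n) :
    evenTerm q (n + 2) (s + 1) a = evenTerm q (n + 1) (s + 1) a * (1 - a * q ^ (n - s))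
      + q ^ (n + 1 - s) * a * evenTerm q n s (a * q) := by
  rcases lt_or_ge n (2 * s) with h | h
  · simp [evenTerm_eq_zero h, evenTerm_eq_zero (show n + 2 < 2 * (s + 1) by omega),
      evenTerm_eq_zero (show n + 1 < 2 * (s + 1) by omega)]
  obtain ⟨N, rfl⟩ := Nat.exists_eq_add_of_le' h
  have e1 : N + 2 * s + 2 - (s + 1) = N + s + 1 := by omega
  have e2 : N + 2 * s + 2 - 2 * (s + 1) = N := by omega
  have e3 : N + 2 * s - s = N + s := by omega
  have e4 : N + 2 * s + 1 - s = N + s + 1 := by omega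
  have e5 : N + 2 * s - 2 * s = N := by omega
  have e6 : N + 2 * s + 1 - (s + 1) = N + s := by omega
  rw [evenTerm, evenTerm, evenTerm, e1, e2, e3, e4, e5, e6, gaussBinom_pascal]
  rcases N with _ | N
  · rw [gaussBinom_eq_zero (show 0 + s < s + 1 by omega)]
    simp only [qPoch, Finset.prod_range_zero]
    ring
  · rw [show N + 1 + 2 * s + 1 - 2 * (s + 1) = N by omega,
      show a * q * q ^ s = a * q ^ (s + 1) by ring, qPoch_succ]
    ring

/-- The recurrence coming from the second `q`-Pascal rule, with the first factor of the shifted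
factorial split off; both summands have the parameter `a * q`. -/
theorem evenTerm_add_two' (q a : K) (n s : ℕ) :
    evenTerm q (n + 2) (s + 1) a = evenTerm q (n + 1) (s + 1) (a * q) * (1 - a * q ^ (s + 1))
      + a * q ^ (s + 1) * evenTerm q n s (a * q) := by
  rcases lt_or_ge n (2 * s) with h | h
  · simp [evenTerm_eq_zero h, evenTerm_eq_zero (show n + 2 < 2 * (s + 1) by omega),
      evenTerm_eq_zero (show n + 1 < 2 * (s + 1) by omega)]
  obtain ⟨N, rfl⟩ := Nat.exists_eq_add_of_le' h
  have e1 : N + 2 * s + 2 - (s + 1) = N + s + 1 := by omega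
  have e2 : N + 2 * s + 2 - 2 * (s + 1) = N := by omega
  have e3 : N + 2 * s - s = N + s := by omega
  have e5 : N + 2 * s - 2 * s = N := by omega
  have e6 : N + 2 * s + 1 - (s + 1) = N + s := by omega
  rw [evenTerm, evenTerm, evenTerm, e1, e2, e3, e5, e6, gaussBinom_pascal']
  rcases N with _ | N
  · rw [gaussBinom_eq_zero (show 0 + s < s + 1 by omega)]
    simp only [qPoch, Finset.prod_range_zero]
    ring
  · rw [show N + 1 + 2 * s + 1 - 2 * (s + 1) = N by omega,
      show a * q * q ^ s = a * q ^ (s + 1) by ring, qPoch_succ',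
      show a * q * q ^ (s + 1) = a * q ^ (s + 1) * q by ring]
    ring

/-! ### The sum of the terms of even index -/

/-- The sum of the terms of even index of the sum of order `n`, after multiplication by `(a; q)_n`.
The terms with `n < 2s` are zero. -/
noncomputable def evenSum (q : K) (n : ℕ) (a : K) : K :=
  ∑ s ∈ Finset.range (n + 1), evenTerm q n s a

theorem evenSum_eq_sum_range (q a : K) {n M : ℕ} (h : n < 2 * M) :
    evenSum q n a = ∑ s ∈ Finset.range M, evenTerm q n s a := by
  have key : ∀ L, n < 2 * L → ∑ s ∈ Finset.range (n + 1 + M), evenTerm q n s a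
      = ∑ s ∈ Finset.range (min L (n + 1 + M)), evenTerm q n s a := fun L hL =>
    (Finset.sum_subset (Finset.range_subset_range.2 (min_le_right _ _)) fun s hs hs' =>
      evenTerm_eq_zero (by simp at hs hs'; omega) q a).symm
  have h1 := key (n + 1) (by omega)
  have h2 := key M h
  rw [min_eq_left (by omega)] at h1 h2
  rw [evenSum, ← h1, h2]

theorem evenSum_sub_rec (q a : K) (n : ℕ) :
    evenSum q (n + 3) a - evenSum q (n + 2) a
      = a ^ 2 * q ^ (n + 2) * (evenSum q (n + 1) (a * q) - evenSum q n (a * q)) := by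
  -- The first recurrence leaves a sum of differences weighted by powers of `q`.
  have h1 : evenSum q (n + 3) a - evenSum q (n + 2) a
      = -a * ∑ s ∈ Finset.range (n + 3),
          q ^ (n + 2 - s) * (evenTerm q (n + 2) s a - evenTerm q (n + 1) s (a * q)) := by
    simp only [mul_sub, Finset.sum_sub_distrib]
    rw [Finset.sum_range_succ' (fun s => q ^ (n + 2 - s) * evenTerm q (n + 2) s a),
      Finset.sum_range_succ (fun s => q ^ (n + 2 - s) * evenTerm q (n + 1) s (a * q)),
      evenTerm_eq_zero (show n + 1 < 2 * (n + 2) by omega),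
      evenSum_eq_sum_range q a (show n + 3 < 2 * (n + 2 + 1) by omega),
      evenSum_eq_sum_range q a (show n + 2 < 2 * (n + 2 + 1) by omega),
      Finset.sum_range_succ', Finset.sum_range_succ' _ (n + 2)]
    have h : ∀ s ∈ Finset.range (n + 2), evenTerm q (n + 3) (s + 1) a
        = evenTerm q (n + 2) (s + 1) a
          + (-a * (q ^ (n + 2 - (s + 1)) * evenTerm q (n + 2) (s + 1) a)
            + a * (q ^ (n + 2 - s) * evenTerm q (n + 1) s (a * q))) := fun s hs => by
      have hs := Finset.mem_range.1 hs
      rw [evenTerm_add_two q a (show s ≤ n + 1 by omega),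
        show n + 2 - (s + 1) = n + 1 - s by omega]
      ring
    rw [Finset.sum_congr rfl h, Finset.sum_add_distrib, Finset.sum_add_distrib, ← Finset.mul_sum,
      ← Finset.mul_sum, evenTerm_zero, evenTerm_zero, qPoch_succ a q (n + 2), Nat.sub_zero]
    ring
  -- The second recurrence turns every weight into the same power `q ^ (n + 2)`.
  have h2 : ∑ s ∈ Finset.range (n + 3),
        q ^ (n + 2 - s) * (evenTerm q (n + 2) s a - evenTerm q (n + 1) s (a * q))
      = -(a * q ^ (n + 2)) * (evenSum q (n + 1) (a * q) - evenSum q n (a * q)) := by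
    rw [evenSum_eq_sum_range q (a * q) (show n + 1 < 2 * (n + 2 + 1) by omega),
      evenSum_eq_sum_range q (a * q) (show n < 2 * (n + 2) by omega),
      Finset.sum_range_succ', Finset.sum_range_succ' _ (n + 2)]
    have h : ∀ s ∈ Finset.range (n + 2), q ^ (n + 2 - (s + 1))
          * (evenTerm q (n + 2) (s + 1) a - evenTerm q (n + 1) (s + 1) (a * q))
        = -(a * q ^ (n + 2)) * evenTerm q (n + 1) (s + 1) (a * q)
          + a * q ^ (n + 2) * evenTerm q n s (a * q) := fun s hs => by
      have hs := Finset.mem_range.1 hs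
      have e : q ^ (n + 2) = q ^ (n + 2 - (s + 1)) * q ^ (s + 1) := by
        rw [← pow_add]
        congr 1
        omega
      rw [evenTerm_add_two', e]
      ring
    rw [Finset.sum_congr rfl h, Finset.sum_add_distrib, ← Finset.mul_sum, ← Finset.mul_sum,
      evenTerm_zero, evenTerm_zero, qPoch_succ' a q (n + 1), Nat.sub_zero]
    ring
  rw [h1, h2]
  ring

theorem evenSum_zero (q a : K) : evenSum q 0 a = 1 := by
  simp [evenSum, evenTerm_zero, qPoch]

theorem evenSum_one (q a : K) : evenSum q 1 a = 1 - a := by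
  rw [evenSum_eq_sum_range q a (show 1 < 2 * 1 by omega)]
  simp [evenTerm_zero, qPoch]

theorem evenSum_two (q a : K) : evenSum q 2 a = 1 - a + a ^ 2 * q := by
  rw [evenSum_eq_sum_range q a (show 2 < 2 * 2 by omega), Finset.sum_range_succ,
    Finset.sum_range_one, evenTerm_add_two q a le_rfl, evenTerm_zero, evenTerm_zero,
    evenTerm_eq_zero (by omega)]
  simp [qPoch, Finset.prod_range_succ]
  ring

/-- The increment `evenSum q (n + 1) a - evenSum q n a` equals
`(-a) ^ (n + 1) * q ^ (n * (n + 1) / 2)`; only this functional equation for it is needed. -/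
theorem evenSum_sub_eq (q : K) (n : ℕ) (a : K) :
    evenSum q (n + 2) a - evenSum q (n + 1) a
      = -a * (evenSum q (n + 1) (a * q) - evenSum q n (a * q)) := by
  induction n using Nat.twoStepInduction generalizing a with
  | zero =>
    rw [evenSum_two, evenSum_one, evenSum_one, evenSum_zero]
    ring
  | one =>
    rw [evenSum_sub_rec q a 0, evenSum_two, evenSum_one, evenSum_zero]
    ring
  | more n ih _ =>
    rw [evenSum_sub_rec q a (n + 1), evenSum_sub_rec q (a * q) n, ih]
    ring

theorem evenSum_succ_add (q : K) (n : ℕ) (a : K) :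
    evenSum q (n + 1) a + a * evenSum q n (a * q) = 1 := by
  induction n with
  | zero =>
    rw [evenSum_one, evenSum_zero]
    ring
  | succ n ih => linear_combination ih + evenSum_sub_eq q n a

/-! ### The full sum -/

theorem sum_range_two_mul {M : Type*} [AddCommMonoid M] (f : ℕ → M) (n : ℕ) :
    ∑ m ∈ Finset.range (2 * n), f m = ∑ s ∈ Finset.range n, (f (2 * s) + f (2 * s + 1)) := by
  induction n with
  | zero => simp
  | succ n ih =>
    rw [show 2 * (n + 1) = 2 * n + 1 + 1 by ring, Finset.sum_range_succ, Finset.sum_range_succ, ih,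
      Finset.sum_range_succ, add_assoc]

/-- The identity of part (2) multiplied by `(a; q)_n`; it holds without any restriction on `a`
and `q`. -/
theorem sum_gaussBinom_mul_qPoch (q a : K) (n : ℕ) :
    ∑ m ∈ Finset.range (n + 1), (a * q ^ (m / 2)) ^ ((m + 1) / 2)
      * gaussBinom (n - (m + 1) / 2) (m / 2) q
      * qPoch (a * q ^ ((m + 1) / 2)) q (n - m) = 1 := by
  rcases n with _ | n
  · simp [gaussBinom_zero_right, qPoch]
  have hext : Finset.range (n + 1 + 1) ⊆ Finset.range (2 * (n + 1)) :=
    Finset.range_subset_range.2 (by omega)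
  rw [Finset.sum_subset hext fun m _ hm => by
      have hm := mt Finset.mem_range.2 hm
      rw [gaussBinom_eq_zero (by omega), mul_zero, zero_mul],
    sum_range_two_mul, Finset.sum_add_distrib, ← evenSum_succ_add q n a,
    evenSum_eq_sum_range q a (show n + 1 < 2 * (n + 1) by omega), evenSum, Finset.mul_sum]
  congr 1 <;> refine Finset.sum_congr rfl fun s _ => ?_
  · rw [evenTerm, show 2 * s / 2 = s by omega, show (2 * s + 1) / 2 = s by omega]
  · rw [evenTerm, show (2 * s + 1) / 2 = s by omega, show (2 * s + 1 + 1) / 2 = s + 1 by omega,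
      show n + 1 - (s + 1) = n - s by omega, show n + 1 - (2 * s + 1) = n - 2 * s by omega,
      show a * q * q ^ s = a * q ^ (s + 1) by ring]
    ring

theorem sum_gaussBinom_div_qPoch (n : ℕ) (a q : K) (hq : q ≠ 0)
    (h : ∀ i ∈ Finset.range n, a * q ^ i ≠ 1) :
    ∑ m ∈ Finset.range (n + 1),
      (a * q ^ (m / 2)) ^ ((m + 1) / 2) * gaussBinom (n - (m + 1) / 2) (m / 2) q
        / (qPoch a q ((m + 1) / 2) * qPoch (a * q ^ (n - 1)) q⁻¹ (m / 2))
      = 1 / qPoch a q n := by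
  have h0 : qPoch a q n ≠ 0 :=
    Finset.prod_ne_zero_iff.2 fun i hi => sub_ne_zero.2 (h i hi).symm
  rw [eq_div_iff h0, ← sum_gaussBinom_mul_qPoch q a n, Finset.sum_mul]
  refine Finset.sum_congr rfl fun m hm => ?_
  have hm := Finset.mem_range.1 hm
  have e : qPoch a q n = qPoch a q ((m + 1) / 2) * qPoch (a * q ^ ((m + 1) / 2)) q (n - m)
      * qPoch (a * q ^ (n - 1)) q⁻¹ (m / 2) := by
    have e1 := qPoch_inv a hq ((m + 1) / 2 + (n - m)) (m / 2)
    have e2 : (m + 1) / 2 + (n - m) + m / 2 = n := by omega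
    rw [e2] at e1
    rw [e1, ← qPoch_add, ← qPoch_add, e2]
  rw [e] at h0 ⊢
  have h1 := right_ne_zero_of_mul h0
  have h2 := left_ne_zero_of_mul (left_ne_zero_of_mul h0)
  rw [div_mul_eq_mul_div, div_eq_iff (mul_ne_zero h2 h1)]
  ring

end Gauss

theorem mainTheorem8 (K : Type*) [Field K] (n : ℕ) :
    (∀ x y : K, x ≠ 0 → y ≠ 0 → (∀ i ∈ Finset.Icc 1 n, x ^ i * y ^ (i - 1) ≠ 1) →
      ∑ m ∈ Finset.range (n + 1),
        (x ^ (m / 2 + 1) * y ^ (m / 2)) ^ ((m + 1) / 2)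
          * gaussBinom (n - (m + 1) / 2) (m / 2) (x * y)
          / (qPoch x (x * y) ((m + 1) / 2)
              * qPoch (x ^ n * y ^ (n - 1)) (x * y)⁻¹ (m / 2))
        = ∏ i ∈ Finset.Icc 1 n, 1 / (1 - x ^ i * y ^ (i - 1))) ∧
    (∀ a q : K, q ≠ 0 → (∀ i ∈ Finset.range n, a * q ^ i ≠ 1) →
      ∑ m ∈ Finset.range (n + 1),
        (a * q ^ (m / 2)) ^ ((m + 1) / 2)
          * gaussBinom (n - (m + 1) / 2) (m / 2) q
          / (qPoch a q ((m + 1) / 2) * qPoch (a * q ^ (n - 1)) q⁻¹ (m / 2))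
        = 1 / qPoch a q n) := by
  refine ⟨fun x y hx hy h => ?_, fun a q => sum_gaussBinom_div_qPoch n a q⟩
  have e : ∀ i, x ^ (i + 1) * y ^ i = x * (x * y) ^ i := fun i => by ring
  have h' : ∀ i ∈ Finset.range n, x * (x * y) ^ i ≠ 1 := fun i hi => by
    rw [← e]
    exact h (i + 1) (by simp at hi ⊢; omega)
  have hprod : ∏ i ∈ Finset.Icc 1 n, 1 / (1 - x ^ i * y ^ (i - 1)) = 1 / qPoch x (x * y) n := by
    rw [Finset.prod_div_distrib, Finset.prod_const_one, qPoch, ← Finset.Ico_add_one_right_eq_Icc,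
      Finset.prod_Ico_eq_prod_range]
    simp only [add_tsub_cancel_right, add_comm 1, e]
  rw [hprod, ← sum_gaussBinom_div_qPoch n x (x * y) (mul_ne_zero hx hy) h']
  refine Finset.sum_congr rfl fun m hm => ?_
  have hm := Finset.mem_range.1 hm
  rw [e]
  rcases n with _ | n
  · -- The exponent `n - 1` is truncated here, but the shifted factorial it enters is empty.
    obtain rfl : m = 0 := by omega
    simp [qPoch]
  · rw [Nat.add_sub_cancel, e]
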